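/- Let $\Gamma$ be a finite connected bridgeless $3$-valent graph (multiple edges allowed) with vertex set $V$, edge set $E$ and set of half-edges $H$, embedded in the oriented sphere $S^2$. For an orientation of the edges, write $s(e),t(e)$ for the source and target of an edge $e$ and also for the corresponding half-edges of $e$. The orientation is a Kasteleyn orientation if for each face $f$ the number of edges on $\partial f$ whose orientation differs from the counter-clockwise orientation of $\partial f$ induced by $f$ (with $f$ on the left) is odd. An angle $\alpha$ is a pair of distinct half-edges with the same end vertex $v$; we write $\alpha=(s(\alpha),t(\alpha))$, where the half-edge $t(\alpha)$ follows $s(\alpha)$ in the counter-clockwise cyclic order around $v$. For real couplings $(y_e)_{e\in E}$ let $$Z^{\mathrm{Ising}}(\Gamma,\{y_e\})=\sum_{\sigma:V\to\{\pm1\}}\exp\Big(\sum_{e\in E}y_e\,\sigma_{s(e)}\sigma_{t(e)}\Big).$$ Let $(\psi_h)_{h\in H}$ be anticommuting Grassmann variables indexed by the half-edges, and for commuting parameters $X_\alpha$ let $$Z_f(\Gamma,\{X_\alpha\})=\int\prod_{e}d\psi_{t(e)}\,d\psi_{s(e)}\;\exp\Big(\sum_{e\in E}\psi_{t(e)}\psi_{s(e)}+\sum_{\alpha}X_\alpha\,\psi_{s(\alpha)}\psi_{t(\alpha)}\Big),$$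 where the Berezin integral is the linear form on the Grassmann algebra that vanishes on products of fewer than $2\,\#E$ generators and is normalized by $\int\prod_e d\psi_{t(e)}d\psi_{s(e)}\prod_e\psi_{t(e)}\psi_{s(e)}=1$. Then for every Kasteleyn orientation of $\Gamma$ the following hold. 1. Let $y_e\in\mathbb R$, $Y_e=\tanh y_e$, let $r_e\in\mathbb C$ be any choice of square roots, $r_e^2=Y_e$, and put $X_\alpha=(Y_eY_{e'})^{1/2}:=r_e r_{e'}$ for an angle $\alpha$ with half-edges $s(\alpha)$ in $e$ and $t(\alpha)$ in $e'$. Then $$Z^{\mathrm{Ising}}(\Gamma,\{y_e\})=\Big(\prod_{e\in E}\cosh y_e\Big)\,2^{\#V}\,Z_f(\Gamma,\{X_\alpha\}).$$ 2. In particular, if $y_e\ge0$ for all $e$, the same formula holds over $\mathbb R$ with the nonnegative square roots $X_\alpha=\sqrt{Y_eY_{e'}}$. 3. Equivalently, for all $Y_e\in\mathbb C$ and all choices of $r_e\in\mathbb C$ with $r_e^2=Y_e$, with $X_\alpha=r_er_{e'}$ as above, $$Z_f(\Gamma,\{X_\alpha\})=\sum_{\gamma}\ \prod_{e\in\gamma}Y_e,$$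 where $\gamma$ runs over the even subgraphs of $\Gamma$, i.e. the sets of edges such that every vertex is incident to an even number of edges of $\gamma$; every even subgraph contributes with sign $+1$. -/

import Mathlib

noncomputable section

/-- A finite graph (multiple edges and loops allowed) with vertices `V`, edges `E` and half-edges
`H`, embedded in a closed oriented surface.  The embedding, up to isotopy, is recorded by the
permutation `next` which sends a half-edge to the following one in the counter-clockwise cyclic
order around its vertex. -/
structure EmbeddedGraph (V E H : Type*) where
  /-- the vertex to which a half-edge is incident -/
  vert : H → V
  /-- the edge containing a half-edge -/
  edge : H → E
  /-- the other half of the same edge -/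
  flip : Equiv.Perm H
  /-- the counter-clockwise successor of a half-edge around its vertex -/
  next : Equiv.Perm H
  edge_surjective : Function.Surjective edge
  flip_ne : ∀ h, flip h ≠ h
  edge_eq_iff : ∀ h h', edge h' = edge h ↔ h' = h ∨ h' = flip h
  vert_eq_iff : ∀ h h', vert h = vert h' ↔ next.SameCycle h h'

namespace EmbeddedGraph

variable {V E H : Type*} (Γ : EmbeddedGraph V E H)

/-- Every vertex is incident to exactly three half-edges. -/
def IsTrivalent : Prop := ∀ v : V, Nat.card {h : H // Γ.vert h = v} = 3

/-- The graph obtained by keeping all the vertices and only the edges of `S` is connected. -/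
def ConnectedOn (S : Set E) : Prop :=
  Nonempty V ∧ ∀ u v : V, Relation.ReflTransGen
    (fun a b => ∃ h : H, Γ.edge h ∈ S ∧ Γ.vert h = a ∧ Γ.vert (Γ.flip h) = b) u v

/-- Connectedness. -/
def IsConnected : Prop := Γ.ConnectedOn Set.univ

/-- No edge disconnects the graph. -/
def IsBridgeless : Prop := ∀ e : E, Γ.ConnectedOn {e}ᶜ

/-- A half-edge `h` is also an oriented edge, the one leaving `vert h`.  The permutation
`faceNext` sends it to the oriented edge which follows it on the boundary of the face lying to its
left, i.e. on that boundary with the counter-clockwise orientation induced by the face: at the end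
of `h` one turns into the half-edge preceding `flip h` in the counter-clockwise order. -/
def faceNext : Equiv.Perm H := Γ.flip.trans Γ.next.symm

/-- The faces: the cycles of `faceNext`. -/
def Face : Type _ := Quotient (Equiv.Perm.SameCycle.setoid Γ.faceNext)

/-- A connected graph in a closed oriented surface whose complementary regions are discs is a graph
embedded in the sphere iff the Euler characteristic of the surface is `2`. -/
def IsPlanar : Prop :=
  (Nat.card V : ℤ) - (Nat.card E : ℤ) + (Nat.card Γ.Face : ℤ) = 2

/-- An orientation of the edges: the choice of the source half-edge of each edge. -/
structure Orientation where
  /-- the source half-edge of an edge -/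
  src : E → H
  edge_src : ∀ e, Γ.edge (src e) = e

variable {Γ}

/-- The target half-edge of an edge. -/
def Orientation.tgt (o : Γ.Orientation) (e : E) : H := Γ.flip (o.src e)

/-- A Kasteleyn orientation: going around any face in the sense induced by the face, the number of
edges whose orientation does not match this sense is odd. -/
def Orientation.IsKasteleyn (o : Γ.Orientation) : Prop :=
  ∀ h₀ : H, Odd (Nat.card {h : H // Γ.faceNext.SameCycle h₀ h ∧ o.src (Γ.edge h) ≠ h})

variable (Γ)

/-- In a trivalent graph, the angles (pairs of distinct half-edges with the same endpoint)
correspond to the half-edges: `h` gives the angle with source half-edge `h` and with target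
half-edge `next h`. -/
theorem existsUnique_angle [Finite H] (h3 : Γ.IsTrivalent) {a b : H} (hab : a ≠ b)
    (hv : Γ.vert a = Γ.vert b) :
    ∃! h : H, (h = a ∧ Γ.next h = b) ∨ (h = b ∧ Γ.next h = a) := by
  classical
  cases nonempty_fintype H
  have hfix : Γ.next a ≠ a := fun hf => hab <| by
    obtain ⟨i, hi⟩ := (Γ.vert_eq_iff a b).1 hv
    rw [← hi, Equiv.Perm.zpow_apply_eq_self_of_apply_eq_self hf]
  have ha : a ∈ Γ.next.support := Equiv.Perm.mem_support.2 hfix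
  have hcard : (Γ.next.cycleOf a).support.card = 3 := by
    rw [← h3 (Γ.vert a), Nat.card_eq_fintype_card, Fintype.card_subtype]
    congr 1
    ext h
    rw [Equiv.Perm.mem_support_cycleOf_iff, Finset.mem_filter]
    simp only [ha, and_true, Finset.mem_univ, true_and]
    rw [← Γ.vert_eq_iff, eq_comm]
  have h3a : Γ.next (Γ.next (Γ.next a)) = a := by
    have h1 := (Equiv.Perm.isCycle_cycleOf Γ.next hfix).orderOf
    rw [hcard] at h1
    have h2 := pow_orderOf_eq_one (Γ.next.cycleOf a)
    rw [h1] at h2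
    have h4 := Equiv.Perm.cycleOf_pow_apply_self Γ.next a 3
    rw [h2] at h4
    simpa [pow_succ] using h4.symm
  obtain ⟨i, hi, hb⟩ := ((Γ.vert_eq_iff a b).1 hv).exists_pow_eq_of_mem_support ha
  rw [hcard] at hi
  interval_cases i
  · exact absurd (by simpa using hb) hab
  · have hb' : Γ.next a = b := by simpa using hb
    refine ⟨a, Or.inl ⟨rfl, hb'⟩, ?_⟩
    rintro h (⟨rfl, -⟩ | ⟨rfl, h2⟩)
    · rfl
    · rw [hb', h2] at h3a
      exact absurd h3a hfix
  · have hb' : Γ.next (Γ.next a) = b := by simpa [pow_succ] using hb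
    refine ⟨b, Or.inr ⟨rfl, by rw [← hb', h3a]⟩, ?_⟩
    rintro h (⟨rfl, h2⟩ | ⟨rfl, -⟩)
    · exact absurd (Γ.next.injective (hb'.trans h2.symm)) hfix
    · rfl

/-- The finite set of even subgraphs, as sets of edges: every vertex is incident to an even number
of half-edges of the subgraph. -/
def evenSubgraphs [Fintype E] : Finset (Finset E) :=
  open Classical in
  Finset.univ.filter fun γ : Finset E =>
    ∀ v : V, Even (Nat.card {h : H // Γ.vert h = v ∧ Γ.edge h ∈ γ})

variable {Γ}

/-- The partition function of the Ising model with couplings `y`; a spin configuration is a map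
from the vertices to `{1, -1} = ℤˣ`. -/
def isingZ [Fintype V] [Fintype E] (o : Γ.Orientation) (y : E → ℝ) : ℝ :=
  open Classical in
  ∑ σ : V → ℤˣ, Real.exp (∑ e : E, y e *
    (((σ (Γ.vert (o.src e)) : ℤ) : ℝ) * ((σ (Γ.vert (o.tgt e)) : ℤ) : ℝ)))

section Grassmann

variable (K : Type*) [CommRing K]

/-- The Grassmann algebra over `K` with one generator for each half-edge. -/
abbrev Grassmann (H : Type*) : Type _ := ExteriorAlgebra K (H → K)

/-- The Grassmann variable of a half-edge. -/
def psi (h : H) : Grassmann K H :=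
  open Classical in ExteriorAlgebra.ι K (Pi.single h (1 : K))

variable {K}

theorem psi_mul_self (h : H) : psi K h * psi K h = 0 := ExteriorAlgebra.ι_sq_zero _

theorem psi_mul_comm (h h' : H) : psi K h * psi K h' = -(psi K h' * psi K h) :=
  eq_neg_of_add_eq_zero_left (ExteriorAlgebra.ι_add_mul_swap _ _)

theorem commute_psi_mul_psi (a b c d : H) :
    Commute (psi K a * psi K b) (psi K c * psi K d) := by
  have key : ∀ x : H, Commute (psi K a * psi K b) (psi K x) := fun x => by
    rw [commute_iff_eq, mul_assoc, psi_mul_comm b x, mul_neg, ← mul_assoc, psi_mul_comm a x,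
      neg_mul, neg_neg, mul_assoc]
  exact (key c).mul_right (key d)

/-- Each half-edge is, in exactly one way, the target (`0`) or source (`1`) half of an edge. -/
theorem Orientation.bijective_halves (o : Γ.Orientation) :
    Function.Bijective fun p : E × Fin 2 => if p.2 = 0 then o.tgt p.1 else o.src p.1 := by
  have ht : ∀ e, Γ.edge (o.tgt e) = e := fun e =>
    ((Γ.edge_eq_iff _ _).2 (Or.inr rfl)).trans (o.edge_src e)
  have hne : ∀ e e', o.src e ≠ o.tgt e' := fun e e' h => by
    have h1 := congrArg Γ.edge h
    rw [o.edge_src, ht] at h1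
    subst h1
    exact Γ.flip_ne _ h.symm
  constructor
  · rintro ⟨e, i⟩ ⟨e', j⟩ h
    fin_cases i <;> fin_cases j <;> simp at h ⊢
    · simpa [ht] using congrArg Γ.edge h
    · exact hne _ _ h.symm
    · exact hne _ _ h
    · simpa [o.edge_src] using congrArg Γ.edge h
  · intro h
    rcases (Γ.edge_eq_iff (o.src (Γ.edge h)) h).1 (o.edge_src _).symm with h1 | h1
    · exact ⟨(Γ.edge h, 1), by simpa using h1.symm⟩
    · exact ⟨(Γ.edge h, 0), by simpa [Orientation.tgt] using h1.symm⟩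

/-- The half-edges in the order `t(e₁), s(e₁), t(e₂), s(e₂), …`, for some enumeration of the
edges. -/
def Orientation.halfEdgeOrder [Fintype E] (o : Γ.Orientation) :
    Fin (Fintype.card E * 2) ≃ H :=
  (finProdFinEquiv.symm.trans
    (Equiv.prodCongr (Fintype.equivFin E).symm (Equiv.refl (Fin 2)))).trans
    (Equiv.ofBijective _ o.bijective_halves)

variable (K) in
/-- The Berezin integral `∫ ∏ₑ dψ_{t(e)} dψ_{s(e)}`: the linear form on the Grassmann algebra which
vanishes on the products of less than `2 #E` generators, and is normalized to take the value `1` at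
`∏ₑ ψ_{t(e)} ψ_{s(e)}` (see `berezin_of_ne` and `berezin_top`). -/
def berezin [Fintype E] (o : Γ.Orientation) : Grassmann K H →ₗ[K] K :=
  ExteriorAlgebra.liftAlternating fun k =>
    if hk : Fintype.card E * 2 = k then
      ((Matrix.detRowAlternating (n := Fin (Fintype.card E * 2)) (R := K)).compLinearMap
        (LinearMap.funLeft K K o.halfEdgeOrder)).domDomCongr (finCongr hk)
    else 0

theorem berezin_of_ne [Fintype E] (o : Γ.Orientation) {k : ℕ} (hk : k ≠ Fintype.card E * 2)
    (v : Fin k → H → K) : berezin K o (ExteriorAlgebra.ιMulti K k v) = 0 := by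
  rw [berezin, ExteriorAlgebra.liftAlternating_apply_ιMulti, dif_neg (Ne.symm hk)]
  rfl

/-- The normalization, for every enumeration `l` of the edges. -/
theorem berezin_top [Fintype E] (o : Γ.Orientation) (l : List E) (hl : l.Nodup)
    (hmem : ∀ e, e ∈ l) :
    berezin K o (l.map fun e => psi K (o.tgt e) * psi K (o.src e)).prod = 1 := by
  classical
  set f : E → Grassmann K H := fun e => psi K (o.tgt e) * psi K (o.src e) with hf
  set l₀ : List E := List.ofFn (Fintype.equivFin E).symm with hl₀
  have hperm : l.Perm l₀ := by
    refine (List.perm_ext_iff_of_nodup hl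
      (List.nodup_ofFn.2 (Fintype.equivFin E).symm.injective)).2 fun e => ?_
    simp only [hmem, List.mem_ofFn, true_iff]
    exact (Fintype.equivFin E).symm.surjective e
  have hprod : (l.map f).prod = (l₀.map f).prod := by
    refine (hperm.map f).prod_eq' (List.pairwise_of_forall_mem_list fun x hx y hy => ?_)
    obtain ⟨e, -, rfl⟩ := List.mem_map.1 hx
    obtain ⟨e', -, rfl⟩ := List.mem_map.1 hy
    exact commute_psi_mul_psi _ _ _ _
  have hlist : (l₀.map f).prod = ExteriorAlgebra.ιMulti K (Fintype.card E * 2)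
      fun i => Pi.single (o.halfEdgeOrder i) (1 : K) := by
    rw [ExteriorAlgebra.ιMulti_apply, List.ofFn_mul, List.prod_flatten, hl₀, List.map_ofFn,
      List.map_ofFn]
    congr 2
    ext i
    have key : ∀ j : Fin 2, ∀ hj, o.halfEdgeOrder ⟨(i : ℕ) * 2 + (j : ℕ), hj⟩ =
        if j = 0 then o.tgt ((Fintype.equivFin E).symm i)
        else o.src ((Fintype.equivFin E).symm i) := fun j hj => by
      have h1 : (⟨(i : ℕ) * 2 + (j : ℕ), hj⟩ : Fin (Fintype.card E * 2)) =
          finProdFinEquiv (i, j) := Fin.ext (by simp; ring)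
      rw [h1]
      simp [Orientation.halfEdgeOrder]
    have h0 : (i : ℕ) * 2 + 1 < Fintype.card E * 2 := by have := i.2; omega
    have k0 : o.halfEdgeOrder ⟨(i : ℕ) * 2, by omega⟩ = _ := key 0 (by simp)
    have k1 : o.halfEdgeOrder ⟨(i : ℕ) * 2 + 1, h0⟩ = _ := key 1 h0
    simp [f, psi, k0, k1]
  rw [hprod, hlist, berezin, ExteriorAlgebra.liftAlternating_apply_ιMulti, dif_pos rfl]
  rw [AlternatingMap.domDomCongr_apply, AlternatingMap.compLinearMap_apply]
  refine Eq.trans ?_ (Matrix.det_one (n := Fin (Fintype.card E * 2)) (R := K))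
  change Matrix.det _ = _
  congr 1
  ext i j
  simp [Matrix.one_apply, LinearMap.funLeft_apply, Pi.single_apply, eq_comm]

/-- The exponent `∑ₑ ψ_{t(e)} ψ_{s(e)} + ∑_α X_α ψ_{s(α)} ψ_{t(α)}` of the Gaussian.  The angle
`α` from `h` to `next h` is indexed by `h`. -/
def fermionAction [Fintype E] [Fintype H] (o : Γ.Orientation) (X : H → K) : Grassmann K H :=
  ∑ e : E, psi K (o.tgt e) * psi K (o.src e) +
    ∑ h : H, X h • (psi K h * psi K (Γ.next h))

theorem isNilpotent_fermionAction [Fintype E] [Fintype H] (o : Γ.Orientation) (X : H → K) :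
    IsNilpotent (fermionAction o X) := by
  have hnil : ∀ (c : K) (a b : H), IsNilpotent (c • (psi K a * psi K b)) := fun c a b =>
    ⟨2, by
      rw [pow_two, smul_mul_smul_comm, mul_assoc, ← mul_assoc (psi K b), psi_mul_comm b a,
        neg_mul, mul_assoc (psi K a) (psi K b), psi_mul_self, mul_zero, neg_zero, mul_zero,
        smul_zero]⟩
  refine Commute.isNilpotent_add ?_ ?_ ?_
  · exact Commute.sum_left _ _ _ fun e _ => Commute.sum_right _ _ _ fun h _ =>
      (commute_psi_mul_psi _ _ _ _).smul_right _
  · refine Commute.isNilpotent_sum (fun e _ => ?_) fun _ _ _ _ => commute_psi_mul_psi _ _ _ _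
    simpa using hnil 1 (o.tgt e) (o.src e)
  · exact Commute.isNilpotent_sum (fun h _ => hnil _ _ _) fun _ _ _ _ =>
      ((commute_psi_mul_psi _ _ _ _).smul_right _).smul_left _

/-- The real fermionic Gaussian integral. -/
def fermionZ [Algebra ℚ K] [Fintype E] [Fintype H] (o : Γ.Orientation) (X : H → K) : K :=
  berezin K o (IsNilpotent.exp (fermionAction o X))

end Grassmann

end EmbeddedGraph

end

/-!
Expanding the Gaussian, the Berezin integral becomes a sum over sets of edges and angles which cover
every half-edge exactly once. In a trivalent graph such a set is determined by the edges `γ` which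
it leaves out: these form an even subgraph, and the angles used are the ones between consecutive
edges of `γ` (`exists_even_of_berezin_ne_zero`). The commuting factors multiply to
`∏ e ∈ γ, r e ^ 2`, and what remains is the sign with which `γ` contributes. It is the sign of a
permutation `π` of the half-edges carrying the pairs `(t(e), s(e))` to the pairs of the covering
(`berezin_prod_pair_perm`).

On the sphere `γ` is the boundary of a set `S` of faces: modulo `2`, boundaries are contained in
cycles, and connectedness and Euler's formula show that the two spaces have the same dimension
(`range_faceBoundary_eq`, `exists_face_colouring`). This yields a formula for `π`
(`Orientation.boundaryPerm`) as a product of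
* the exchange of the two halves of those edges whose target half-edge, as an oriented edge, has a
  face of `S` on its left, that is, of the edges inside `S` and of the edges of `γ` which disagree
  with the orientation of `γ` as boundary of `S`;
* the permutation `faceNext` restricted to `S`;
* a rotation of order `3` around the vertices inside `S`, and one transposition at each vertex of
  `γ`.

By the Kasteleyn condition, each face of `S`, with `l` edges on its boundary, contributes to the
sign of the second factor `(-1) ^ (l - 1)`, which is the product over its boundary of `-1` for the
edges that agree with the orientation and `+1` for the others. So all signs are products
over the edges of local terms, and they cancel at each edge (`Orientation.IsKasteleyn.sign_boundaryPerm`). No cycle of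
`γ` has to be followed and no Jordan curve theorem is needed.

The statements about the Ising model follow from the expansion of
`exp (y σ σ') = cosh y * (1 + tanh y * σ σ')` and the sum over the spins, which leaves the even
subgraphs (`isingZ_eq_sum_evenSubgraphs`).
-/

namespace EmbeddedGraph

variable {V E H : Type*} {Γ : EmbeddedGraph V E H}

/-! ### Half-edges and edges -/

theorem edge_flip (Γ : EmbeddedGraph V E H) (h : H) : Γ.edge (Γ.flip h) = Γ.edge h :=
  (Γ.edge_eq_iff _ _).2 (Or.inr rfl)

theorem flip_flip (Γ : EmbeddedGraph V E H) (h : H) : Γ.flip (Γ.flip h) = h := by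
  rcases (Γ.edge_eq_iff h (Γ.flip (Γ.flip h))).1 (by rw [edge_flip, edge_flip]) with h1 | h1
  · exact h1
  · exact absurd h1 (Γ.flip_ne _)

theorem Orientation.edge_tgt (o : Γ.Orientation) (e : E) : Γ.edge (o.tgt e) = e := by
  rw [Orientation.tgt, edge_flip, o.edge_src]

theorem Orientation.flip_tgt (o : Γ.Orientation) (e : E) : Γ.flip (o.tgt e) = o.src e :=
  Γ.flip_flip _

theorem Orientation.tgt_ne_src (o : Γ.Orientation) (e : E) : o.tgt e ≠ o.src e := Γ.flip_ne _

theorem Orientation.eq_src_or_eq_tgt (o : Γ.Orientation) (h : H) :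
    h = o.src (Γ.edge h) ∨ h = o.tgt (Γ.edge h) :=
  (Γ.edge_eq_iff _ _).1 (o.edge_src _).symm

@[to_additive]
theorem Orientation.prod_halfEdges [Fintype E] [Fintype H] {M : Type*} [CommMonoid M]
    (o : Γ.Orientation) (f : H → M) : ∏ h, f h = ∏ e, f (o.tgt e) * f (o.src e) := by
  rw [← (Equiv.ofBijective _ o.bijective_halves).prod_comp, Fintype.prod_prod_type]
  simp

theorem Orientation.card_halfEdges [Fintype E] [Fintype H] (o : Γ.Orientation) :
    Fintype.card H = Fintype.card E * 2 := by
  rw [← Fintype.card_congr o.halfEdgeOrder, Fintype.card_fin]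

/-! ### The half-edges at a vertex of a trivalent graph -/

theorem vert_next (Γ : EmbeddedGraph V E H) (h : H) : Γ.vert (Γ.next h) = Γ.vert h :=
  (Γ.vert_eq_iff _ _).2 (Equiv.Perm.sameCycle_apply_left.2 (Equiv.Perm.SameCycle.refl _ _))

theorem IsTrivalent.card_support_cycleOf [Fintype H] [DecidableEq H] (h3 : Γ.IsTrivalent) (a : H) :
    Γ.next a ≠ a ∧ (Γ.next.cycleOf a).support.card = 3 := by
  classical
  have hfix : Γ.next a ≠ a := fun hf => by
    have h1 := h3 (Γ.vert a)
    have : Subsingleton {h : H // Γ.vert h = Γ.vert a} := ⟨by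
      rintro ⟨x, hx⟩ ⟨y, hy⟩
      obtain ⟨i, hi⟩ := (Γ.vert_eq_iff a x).1 hx.symm
      obtain ⟨j, hj⟩ := (Γ.vert_eq_iff a y).1 hy.symm
      rw [Equiv.Perm.zpow_apply_eq_self_of_apply_eq_self hf] at hi hj
      exact Subtype.ext (hi.symm.trans hj)⟩
    have := Finite.card_le_one_iff_subsingleton.2 this
    omega
  refine ⟨hfix, ?_⟩
  rw [← h3 (Γ.vert a), Nat.card_eq_fintype_card, Fintype.card_subtype]
  congr 1
  ext h
  rw [Equiv.Perm.mem_support_cycleOf_iff, Finset.mem_filter]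
  simp only [Equiv.Perm.mem_support.2 hfix, and_true, Finset.mem_univ, true_and]
  rw [← Γ.vert_eq_iff, eq_comm]

theorem IsTrivalent.next_ne [Finite H] (h3 : Γ.IsTrivalent) (h : H) : Γ.next h ≠ h := by
  classical
  cases nonempty_fintype H
  exact (h3.card_support_cycleOf h).1

theorem IsTrivalent.next_next_next [Finite H] (h3 : Γ.IsTrivalent) (a : H) :
    Γ.next (Γ.next (Γ.next a)) = a := by
  classical
  cases nonempty_fintype H
  obtain ⟨hfix, hcard⟩ := h3.card_support_cycleOf a
  have h1 := (Equiv.Perm.isCycle_cycleOf Γ.next hfix).orderOf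
  rw [hcard] at h1
  have h2 := pow_orderOf_eq_one (Γ.next.cycleOf a)
  rw [h1] at h2
  have h4 := Equiv.Perm.cycleOf_pow_apply_self Γ.next a 3
  rw [h2] at h4
  simpa [pow_succ] using h4.symm

theorem IsTrivalent.next_next_ne [Finite H] (h3 : Γ.IsTrivalent) (h : H) : Γ.next (Γ.next h) ≠ h :=
  fun h1 => h3.next_ne h (by rw [← h1, h3.next_next_next, h1])

theorem IsTrivalent.next_symm [Finite H] (h3 : Γ.IsTrivalent) (h : H) :
    Γ.next.symm h = Γ.next (Γ.next h) := by
  rw [Equiv.symm_apply_eq, h3.next_next_next]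

theorem IsTrivalent.faceNext_apply [Finite H] (h3 : Γ.IsTrivalent) (h : H) :
    Γ.faceNext h = Γ.next (Γ.next (Γ.flip h)) := by
  rw [← h3.next_symm]; rfl

theorem IsTrivalent.vert_eq_vert_iff [Finite H] (h3 : Γ.IsTrivalent) (a h : H) :
    Γ.vert h = Γ.vert a ↔ h = a ∨ h = Γ.next a ∨ h = Γ.next (Γ.next a) := by
  constructor
  · intro hv
    by_contra! hne
    obtain ⟨i, hi⟩ := (Γ.vert_eq_iff a h).1 hv.symm
    have h3z : Γ.next ^ (3 : ℤ) = 1 := by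
      ext x
      simpa [zpow_ofNat, pow_succ] using h3.next_next_next x
    rw [← Int.emod_add_mul_ediv i 3, zpow_add, zpow_mul, h3z, one_zpow, mul_one] at hi
    have h0 := Int.emod_nonneg i (show (3 : ℤ) ≠ 0 by norm_num)
    have h1 := Int.emod_lt_of_pos i (show (0 : ℤ) < 3 by norm_num)
    generalize i % 3 = j at *
    interval_cases j
    · exact hne.1 (by simpa using hi.symm)
    · exact hne.2.1 (by simpa using hi.symm)
    · exact hne.2.2 (by simpa [zpow_ofNat, pow_succ] using hi.symm)
  · rintro (rfl | rfl | rfl) <;> simp [vert_next]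

theorem IsTrivalent.exists_vert_eq (h3 : Γ.IsTrivalent) (v : V) : ∃ h, Γ.vert h = v := by
  have h1 := h3 v
  have : Nonempty {h : H // Γ.vert h = v} := by
    by_contra hne
    rw [not_nonempty_iff] at hne
    simp at h1
  obtain ⟨h, hh⟩ := this
  exact ⟨h, hh⟩

open scoped Classical in
theorem sum_vert_eq [Fintype H] {M : Type*} [AddCommMonoid M] (h3 : Γ.IsTrivalent) (a : H)
    (f : H → M) :
    ∑ h with Γ.vert h = Γ.vert a, f h = f a + (f (Γ.next a) + f (Γ.next (Γ.next a))) := by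
  have hs : (Finset.univ.filter fun h => Γ.vert h = Γ.vert a) =
      {a, Γ.next a, Γ.next (Γ.next a)} := by
    ext h; simp [h3.vert_eq_vert_iff]
  rw [hs, Finset.sum_insert, Finset.sum_pair]
  · exact (h3.next_ne _).symm
  · simp [(h3.next_ne a).symm, (h3.next_next_ne a).symm]

open scoped Classical in
theorem card_vert_edge_mem [Fintype H] (γ : Finset E) (v : V) :
    Nat.card {h : H // Γ.vert h = v ∧ Γ.edge h ∈ γ} =
      ∑ h with Γ.vert h = v, if Γ.edge h ∈ γ then 1 else 0 := by
  rw [Nat.card_eq_fintype_card, Fintype.card_subtype, Finset.sum_ite, Finset.sum_const_zero,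
    add_zero, Finset.sum_const, smul_eq_mul, mul_one, Finset.filter_filter]

/-- In a trivalent graph a set of edges is even iff no vertex meets exactly one or exactly three
half-edges of it. -/
theorem mem_evenSubgraphs_iff [Fintype E] [Finite H] (h3 : Γ.IsTrivalent) (γ : Finset E) :
    γ ∈ Γ.evenSubgraphs ↔ ∀ h, (Γ.edge h ∈ γ ↔
      ¬ (Γ.edge (Γ.next h) ∈ γ ↔ Γ.edge (Γ.next (Γ.next h)) ∈ γ)) := by
  classical
  cases nonempty_fintype H
  have key : ∀ h, Even (Nat.card {x : H // Γ.vert x = Γ.vert h ∧ Γ.edge x ∈ γ}) ↔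
      (Γ.edge h ∈ γ ↔ ¬ (Γ.edge (Γ.next h) ∈ γ ↔ Γ.edge (Γ.next (Γ.next h)) ∈ γ)) := by
    intro h
    rw [card_vert_edge_mem, sum_vert_eq h3]
    by_cases h1 : Γ.edge h ∈ γ <;> by_cases h2 : Γ.edge (Γ.next h) ∈ γ <;>
      by_cases h4 : Γ.edge (Γ.next (Γ.next h)) ∈ γ <;> (simp [h1, h2, h4]; try decide)
  rw [evenSubgraphs, Finset.mem_filter]
  constructor
  · exact fun hγ h => (key h).1 (hγ.2 _)
  · refine fun hγ => ⟨Finset.mem_univ _, fun v => ?_⟩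
    obtain ⟨h, rfl⟩ := h3.exists_vert_eq v
    exact (key h).2 (hγ h)

/-! ### Planarity: even subgraphs bound sets of faces -/

/-- The face to the left of an oriented edge. -/
def leftFace (Γ : EmbeddedGraph V E H) (h : H) : Γ.Face :=
  Quotient.mk (Equiv.Perm.SameCycle.setoid Γ.faceNext) h

theorem leftFace_faceNext (h : H) : Γ.leftFace (Γ.faceNext h) = Γ.leftFace h :=
  Quotient.sound (Equiv.Perm.sameCycle_apply_left.2 (Equiv.Perm.SameCycle.refl _ _))

/-- The corners on the two sides of a half-edge: the face to the right of `h` lies to the left of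
the preceding half-edge at the same vertex. -/
theorem leftFace_flip (h : H) : Γ.leftFace (Γ.flip h) = Γ.leftFace (Γ.next.symm h) := by
  rw [← leftFace_faceNext (Γ.flip h)]
  simp [faceNext, flip_flip]

/-- A property of vertices which is invariant along the edges is constant on a connected graph. -/
theorem IsConnected.apply_eq (hconn : Γ.IsConnected) {α : Type*} (u : V → α)
    (hu : ∀ h, u (Γ.vert h) = u (Γ.vert (Γ.flip h))) (v w : V) : u v = u w := by
  induction hconn.2 v w with
  | refl => rfl
  | tail _ hbc ih =>
    obtain ⟨h, -, rfl, rfl⟩ := hbc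
    exact ih.trans (hu h)

/-- A function of the faces which takes the same value on both sides of each edge is constant. -/
theorem IsConnected.face_apply_eq (hconn : Γ.IsConnected) {α : Type*} (x : Γ.Face → α)
    (hx : ∀ h, x (Γ.leftFace h) = x (Γ.leftFace (Γ.flip h))) (h h' : H) :
    x (Γ.leftFace h) = x (Γ.leftFace h') := by
  have hnext : ∀ h, x (Γ.leftFace (Γ.next h)) = x (Γ.leftFace h) := fun h => by
    rw [hx, leftFace_flip, Equiv.symm_apply_apply]
  have hvert : ∀ a b, Γ.vert a = Γ.vert b → x (Γ.leftFace a) = x (Γ.leftFace b) := by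
    intro a b hab
    obtain ⟨i, rfl⟩ := (Γ.vert_eq_iff a b).1 hab
    induction i using Int.induction_on with
    | zero => rfl
    | succ i ih =>
      rw [add_comm, zpow_add, zpow_one, Equiv.Perm.mul_apply, hnext]
      exact ih (by
        rw [hab, add_comm, zpow_add, zpow_one, Equiv.Perm.mul_apply, vert_next])
    | pred i ih =>
      rw [← hnext ((Γ.next ^ (-(i : ℤ) - 1)) a), ← Equiv.Perm.mul_apply, ← zpow_one_add,
        add_sub_cancel]
      exact ih (by
        rw [hab, ← vert_next Γ ((Γ.next ^ (-(i : ℤ) - 1)) a), ← Equiv.Perm.mul_apply,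
          ← zpow_one_add, add_sub_cancel])
  have key : ∀ v w, Relation.ReflTransGen (fun a b => ∃ h : H, Γ.edge h ∈ Set.univ ∧
      Γ.vert h = a ∧ Γ.vert (Γ.flip h) = b) v w →
      ∀ a b, Γ.vert a = v → Γ.vert b = w → x (Γ.leftFace a) = x (Γ.leftFace b) := by
    intro v w hvw
    induction hvw with
    | refl => exact fun a b ha hb => hvert a b (ha.trans hb.symm)
    | tail _ hbc ih =>
      obtain ⟨h, -, h1, rfl⟩ := hbc
      intro a b ha hb
      rw [ih a h ha h1, hx, hvert _ _ hb]
  exact key _ _ (hconn.2 _ _) h h' rfl rfl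

open scoped Classical in
/-- The incidence matrix modulo `2`. -/
noncomputable def incMatrix (o : Γ.Orientation) : Matrix V E (ZMod 2) := fun v e =>
  (if Γ.vert (o.tgt e) = v then 1 else 0) + (if Γ.vert (o.src e) = v then 1 else 0)

open scoped Classical in
theorem incMatrix_mulVec [Fintype E] [Fintype H] (o : Γ.Orientation) (g : E → ZMod 2) (v : V) :
    (incMatrix o).mulVec g v = ∑ h with Γ.vert h = v, g (Γ.edge h) := by
  rw [Finset.sum_filter, o.sum_halfEdges]
  refine Finset.sum_congr rfl fun e _ => ?_
  change incMatrix o v e * g e = _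
  simp [incMatrix, add_mul, o.edge_tgt, o.edge_src]

theorem incMatrix_transpose_mulVec [Fintype V] (o : Γ.Orientation) (u : V → ZMod 2) (e : E) :
    (incMatrix o).transpose.mulVec u e = u (Γ.vert (o.tgt e)) + u (Γ.vert (o.src e)) := by
  classical
  simp [Matrix.mulVec, dotProduct, incMatrix, add_mul, Finset.sum_add_distrib]

/-- A connected graph has incidence matrix of rank at least `#V - 1`, because only the constant
functions are killed by the coboundary. -/
theorem IsConnected.card_le_rank_incMatrix [Fintype V] [Fintype E] (hconn : Γ.IsConnected)
    (o : Γ.Orientation) : Fintype.card V ≤ (incMatrix o).rank + 1 := by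
  classical
  have h1 := LinearMap.finrank_range_add_finrank_ker (incMatrix o).transpose.mulVecLin
  rw [Module.finrank_fintype_fun_eq_card] at h1
  change (incMatrix o).transpose.rank + _ = _ at h1
  rw [Matrix.rank_transpose] at h1
  have h2 : Module.finrank (ZMod 2) (LinearMap.ker (incMatrix o).transpose.mulVecLin) ≤ 1 := by
    obtain ⟨v0⟩ := hconn.1
    refine finrank_le_one ⟨fun _ => 1, ?_⟩ ?_
    · rw [LinearMap.mem_ker]
      ext e
      rw [Matrix.mulVecLin_apply, incMatrix_transpose_mulVec]
      rfl
    · rintro ⟨u, hu⟩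
      refine ⟨u v0, Subtype.ext (funext fun v => ?_)⟩
      have : ∀ h, u (Γ.vert h) = u (Γ.vert (Γ.flip h)) := by
        have h3 : ∀ e, u (Γ.vert (o.tgt e)) = u (Γ.vert (o.src e)) := fun e => by
          have := congrFun (LinearMap.mem_ker.1 hu) e
          rw [Matrix.mulVecLin_apply, incMatrix_transpose_mulVec] at this
          exact CharTwo.add_eq_zero.1 this
        intro h
        rcases o.eq_src_or_eq_tgt h with h4 | h4 <;> rw [h4]
        · exact (h3 _).symm
        · rw [o.flip_tgt, h3]
      simpa using hconn.apply_eq u this v0 v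
  omega

/-- The boundary map modulo `2` from sets of faces to sets of edges. -/
def faceBoundary (o : Γ.Orientation) : (Γ.Face → ZMod 2) →ₗ[ZMod 2] (E → ZMod 2) where
  toFun x e := x (Γ.leftFace (o.tgt e)) + x (Γ.leftFace (o.src e))
  map_add' x y := by ext e; simp only [Pi.add_apply]; ring
  map_smul' a x := by ext e; simp [mul_add]

theorem faceBoundary_edge (o : Γ.Orientation) (x : Γ.Face → ZMod 2) (h : H) :
    faceBoundary o x (Γ.edge h) = x (Γ.leftFace h) + x (Γ.leftFace (Γ.flip h)) := by
  rw [faceBoundary, LinearMap.coe_mk, AddHom.coe_mk]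
  rcases o.eq_src_or_eq_tgt h with h4 | h4
  · rw [add_comm, ← h4, Orientation.tgt, ← h4]
  · rw [← h4, ← o.flip_tgt, ← h4]

theorem IsConnected.card_face_le [Finite H] (hconn : Γ.IsConnected) (o : Γ.Orientation) :
    Nat.card Γ.Face ≤ Module.finrank (ZMod 2) (LinearMap.range (faceBoundary o)) + 1 := by
  classical
  have : Finite Γ.Face := Quotient.finite _
  cases nonempty_fintype Γ.Face
  have h1 := LinearMap.finrank_range_add_finrank_ker (faceBoundary o)
  rw [Module.finrank_fintype_fun_eq_card] at h1
  have h2 : Module.finrank (ZMod 2) (LinearMap.ker (faceBoundary o)) ≤ 1 := by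
    rcases isEmpty_or_nonempty H with hH | ⟨⟨h0⟩⟩
    · have : IsEmpty Γ.Face := Quotient.instIsEmpty
      rw [Fintype.card_eq_zero] at h1
      omega
    refine finrank_le_one ⟨fun _ => 1, ?_⟩ ?_
    · rw [LinearMap.mem_ker]
      rfl
    · rintro ⟨x, hx⟩
      refine ⟨x (Γ.leftFace h0), Subtype.ext (funext fun f => ?_)⟩
      obtain ⟨h, rfl⟩ := Quotient.exists_rep f
      have := hconn.face_apply_eq x (fun h => by
        have := congrFun (LinearMap.mem_ker.1 hx) (Γ.edge h)
        rw [faceBoundary_edge] at this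
        exact CharTwo.add_eq_zero.1 this) h0 h
      exact (mul_one _).trans this
  rw [Nat.card_eq_fintype_card]
  omega

/-- On the sphere the homology modulo `2` in degree `1` vanishes: the cycles contain the boundaries
of sets of faces, and Euler's formula says that both spaces have the same dimension. -/
theorem range_faceBoundary_eq [Fintype V] [Fintype E] [Finite H] (hconn : Γ.IsConnected)
    (hplanar : Γ.IsPlanar) (htri : Γ.IsTrivalent) (o : Γ.Orientation) :
    LinearMap.range (faceBoundary o) = LinearMap.ker (incMatrix o).mulVecLin := by
  classical
  cases nonempty_fintype H
  refine Submodule.eq_of_le_of_finrank_le ?_ ?_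
  · rintro _ ⟨x, rfl⟩
    rw [LinearMap.mem_ker]
    ext v
    obtain ⟨a, rfl⟩ := htri.exists_vert_eq v
    rw [Matrix.mulVecLin_apply, incMatrix_mulVec, sum_vert_eq htri]
    simp only [faceBoundary_edge, leftFace_flip, htri.next_symm, htri.next_next_next,
      Pi.zero_apply]
    have key : ∀ p q r : ZMod 2, p + r + (q + p + (r + q)) = 0 := by decide
    exact key _ _ _
  · have h1 := LinearMap.finrank_range_add_finrank_ker (incMatrix o).mulVecLin
    rw [Module.finrank_fintype_fun_eq_card] at h1
    change (incMatrix o).rank + _ = _ at h1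
    have h2 := hconn.card_le_rank_incMatrix o
    have h3 := hconn.card_face_le o
    have h4 := hplanar
    rw [IsPlanar, Nat.card_eq_fintype_card, Nat.card_eq_fintype_card] at h4
    omega

/-- A planar even subgraph separates a set of faces, given here as a function `c` of the oriented
edges which is constant along the boundary of each face, from its complement. -/
theorem exists_face_colouring [Fintype V] [Fintype E] [Finite H] (hconn : Γ.IsConnected)
    (hplanar : Γ.IsPlanar) (htri : Γ.IsTrivalent) (o : Γ.Orientation) {γ : Finset E}
    (hγ : γ ∈ Γ.evenSubgraphs) :
    ∃ c : H → Bool, (∀ h, c (Γ.faceNext h) = c h) ∧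
      ∀ h, Γ.edge h ∈ γ ↔ c h ≠ c (Γ.flip h) := by
  classical
  cases nonempty_fintype H
  have hmem : (fun e => if e ∈ γ then 1 else 0 : E → ZMod 2) ∈
      LinearMap.range (faceBoundary o) := by
    rw [range_faceBoundary_eq hconn hplanar htri o, LinearMap.mem_ker]
    ext v
    obtain ⟨a, rfl⟩ := htri.exists_vert_eq v
    rw [Matrix.mulVecLin_apply, incMatrix_mulVec, sum_vert_eq htri]
    have := (mem_evenSubgraphs_iff htri γ).1 hγ a
    by_cases h1 : Γ.edge (Γ.next a) ∈ γ <;> by_cases h2 : Γ.edge (Γ.next (Γ.next a)) ∈ γ <;>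
      simp [h1, h2] at this <;> simp [h1, h2, this] <;> rfl
  obtain ⟨x, hx⟩ := hmem
  refine ⟨fun h => decide (x (Γ.leftFace h) = 1), fun h => by simp only [leftFace_faceNext],
    fun h => ?_⟩
  have h1 := congrFun hx (Γ.edge h)
  rw [faceBoundary_edge] at h1
  have h2 : Γ.edge h ∈ γ ↔ (if Γ.edge h ∈ γ then 1 else 0 : ZMod 2) = 1 := by simp
  rw [h2, ← h1]
  have key : ∀ p q : ZMod 2, p + q = 1 ↔ decide (p = 1) ≠ decide (q = 1) := by decide
  exact key _ _

end EmbeddedGraph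

/-! ### Signs of permutations -/

namespace Equiv.Perm

variable {α : Type*} [Fintype α] [DecidableEq α]

theorem sign_eq_prod_support (p : Perm α) (k : α → ℤˣ)
    (hk : ∀ a ∈ p.support, ∏ x ∈ (p.cycleOf a).support, k x = -1) :
    sign p = ∏ a ∈ p.support, -k a := by
  induction p using cycle_induction_on with
  | base_one => simp
  | base_cycles σ hσ =>
    obtain ⟨x, hx, -⟩ := id hσ
    have h1 := hk x (mem_support.2 hx)
    rw [hσ.cycleOf_eq hx] at h1
    rw [hσ.sign, Finset.prod_neg, h1]
    simp
  | induction_disjoint σ τ hd _ hσ hτ =>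
    have hdis := disjoint_iff_disjoint_support.1 hd
    rw [hd.support_mul] at hk ⊢
    rw [sign_mul, Finset.prod_union hdis, hσ, hτ]
    · intro a ha
      have := hk a (Finset.mem_union_right _ ha)
      have h1 := Finset.disjoint_right.1 hdis ha
      rwa [hd.cycleOf_mul_distrib, (cycleOf_eq_one_iff σ).2 (notMem_support.1 h1),
        one_mul] at this
    · intro a ha
      have := hk a (Finset.mem_union_left _ ha)
      have h1 := Finset.disjoint_left.1 hdis ha
      rwa [hd.cycleOf_mul_distrib, (cycleOf_eq_one_iff τ).2 (notMem_support.1 h1),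
        mul_one] at this

/-- A cycle of length `l` has sign `(-1) ^ (l - 1)`; so if a function has product `-1` over each
cycle, fixed points included, then changing its sign everywhere gives a function with product the
sign of the permutation. -/
theorem sign_eq_prod_neg (p : Perm α) (k : α → ℤˣ)
    (hk : ∀ a, ∏ x with p.SameCycle a x, k x = -1) : sign p = ∏ a, -k a := by
  rw [sign_eq_prod_support p k]
  · refine Finset.prod_subset (Finset.subset_univ _) fun a _ ha => ?_
    have h1 : (Finset.univ.filter fun x => p.SameCycle a x) = {a} := by
      ext x
      simp only [Finset.mem_filter, Finset.mem_univ, true_and, Finset.mem_singleton]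
      constructor
      · rintro ⟨i, rfl⟩
        exact zpow_apply_eq_self_of_apply_eq_self (notMem_support.1 ha) i
      · rintro rfl
        exact SameCycle.refl _ _
    have h2 := hk a
    rw [h1, Finset.prod_singleton] at h2
    rw [h2, neg_neg]
  · intro a ha
    rw [← hk a]
    congr 1
    ext x
    rw [mem_support_cycleOf_iff]
    simp [mem_support.1 ha]

/-- `sign_eq_prod_neg` for the restriction to an invariant set. -/
theorem sign_eq_prod_of_eqOn (p q : Perm α) (c : α → Prop) [DecidablePred c] (k : α → ℤˣ)
    (hc : ∀ a, c (p a) ↔ c a) (hq : ∀ a, c a → q a = p a) (hq' : ∀ a, ¬ c a → q a = a)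
    (hk : ∀ a, ∏ x with p.SameCycle a x, k x = -1) :
    sign q = ∏ a, if c a then -k a else 1 := by
  have hq1 : q = ofSubtype (p.subtypePerm hc) := by
    ext a
    by_cases ha : c a
    · rw [hq a ha, ofSubtype_apply_of_mem _ ha, subtypePerm_apply]
    · rw [hq' a ha, ofSubtype_apply_of_not_mem _ ha]
  rw [hq1, sign_ofSubtype, sign_eq_prod_neg (p.subtypePerm hc) fun a : Subtype c => k a]
  · rw [← Finset.prod_filter, Finset.prod_subtype (p := c) _ (by simp)]
  · rintro ⟨a, ha⟩
    rw [← hk a]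
    have hmem : ∀ x, p.SameCycle a x → c x := by
      rintro x ⟨i, rfl⟩
      have h1 := ((p.subtypePerm hc ^ i) ⟨a, ha⟩).2
      rwa [subtypePerm_zpow] at h1
    refine Finset.prod_bij (fun x _ => (x : α)) ?_ ?_ ?_ ?_
    · intro x hx
      simpa [sameCycle_subtypePerm] using hx
    · exact fun x _ y _ h => Subtype.ext h
    · intro x hx
      have hx' := (Finset.mem_filter.1 hx).2
      exact ⟨⟨x, hmem x hx'⟩, by simpa [sameCycle_subtypePerm] using hx', rfl⟩
    · exact fun _ _ => rfl

/-- An involution is a product of as many transpositions as there are elements in a set which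
meets each of its orbits of length `2` in one element, and no other orbit. -/
theorem sign_of_involutive (s : Finset α) (p : Perm α) (hp : ∀ a, p (p a) = a)
    (hs : ∀ a ∈ s, p a ∉ s) (hs' : ∀ a, p a ≠ a → a ∈ s ∨ p a ∈ s) :
    sign p = (-1) ^ s.card := by
  induction s using Finset.induction_on generalizing p with
  | empty =>
    have : p = 1 := by
      ext a
      by_contra h
      simpa using hs' a h
    simp [this]
  | insert a s ha ih =>
    have hne : p a ≠ a := fun h => hs a (Finset.mem_insert_self _ _) (by
      rw [h]; exact Finset.mem_insert_self _ _)
    have hpa : p a ∉ s := fun h => hs a (Finset.mem_insert_self _ _) (Finset.mem_insert_of_mem h)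
    have hq : ∀ x, (swap a (p a) * p) x = if x = a ∨ x = p a then x else p x := by
      intro x
      rw [mul_apply]
      split_ifs with h
      · rcases h with rfl | rfl
        · simp
        · simp [hp]
      · push Not at h
        refine swap_apply_of_ne_of_ne (fun h1 => h.2 ?_) fun h1 => h.1 (p.injective h1)
        rw [← h1, hp]
    have h1 : sign (swap a (p a) * p) = (-1) ^ s.card := by
      refine ih _ (fun x => ?_) (fun x hx => ?_) fun x hx => ?_
      · rw [hq x]
        split_ifs with h
        · rw [hq, if_pos h]
        · push Not at h
          rw [hq, if_neg, hp]
          rintro (h1 | h1)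
          · exact h.2 (by rw [← h1, hp])
          · exact h.1 (p.injective h1)
      · rw [hq, if_neg]
        · exact fun h => hs x (Finset.mem_insert_of_mem hx) (Finset.mem_insert_of_mem h)
        · rintro (rfl | rfl)
          · exact ha hx
          · exact hpa hx
      · rw [hq] at hx ⊢
        split_ifs at hx ⊢ with h
        · exact absurd rfl hx
        · push Not at h
          rcases hs' x hx with h2 | h2
          · exact Or.inl (Finset.mem_of_mem_insert_of_ne h2 h.1)
          · exact Or.inr (Finset.mem_of_mem_insert_of_ne h2 fun h3 => h.2 (by rw [← h3, hp]))
    rw [sign_mul, sign_swap hne.symm] at h1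
    rw [Finset.card_insert_of_notMem ha, pow_succ, ← h1]
    simp

end Equiv.Perm

namespace EmbeddedGraph

variable {V E H : Type*} {Γ : EmbeddedGraph V E H}

/-! ### Orientations and exchanges of half-edges -/

/-- The function on the oriented edges which is `-1` where they disagree with the orientation. -/
def Orientation.mismatch [DecidableEq H] (o : Γ.Orientation) (h : H) : ℤˣ :=
  if o.src (Γ.edge h) = h then 1 else -1

theorem Orientation.IsKasteleyn.prod_mismatch [Fintype H] [DecidableEq H] {o : Γ.Orientation}
    (hK : o.IsKasteleyn) (h₀ : H) :
    ∏ h with Γ.faceNext.SameCycle h₀ h, o.mismatch h = -1 := by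
  classical
  have h1 := hK h₀
  rw [Nat.card_eq_fintype_card, Fintype.card_subtype] at h1
  simp only [Orientation.mismatch]
  rw [Finset.prod_ite, Finset.prod_const_one, one_mul, Finset.prod_const, Finset.filter_filter]
  exact h1.neg_one_pow

/-- The permutation exchanging the two halves of the edges in `D`. -/
def flipOn (Γ : EmbeddedGraph V E H) (D : E → Bool) : Equiv.Perm H :=
  Function.Involutive.toPerm (fun h => if D (Γ.edge h) then Γ.flip h else h) fun h => by
    by_cases hD : D (Γ.edge h) <;> simp [hD, edge_flip, flip_flip]

theorem flipOn_apply (D : E → Bool) (h : H) :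
    Γ.flipOn D h = if D (Γ.edge h) then Γ.flip h else h := rfl

theorem Orientation.sign_flipOn [Fintype E] [Fintype H] [DecidableEq H] (o : Γ.Orientation)
    (D : E → Bool) : Equiv.Perm.sign (Γ.flipOn D) = ∏ e, if D e then -1 else 1 := by
  rw [Equiv.Perm.sign_of_involutive ((Finset.univ.filter fun e => D e = true).image o.src)]
  · rw [Finset.card_image_of_injective _ (Function.LeftInverse.injective o.edge_src),
      ← Finset.prod_filter, Finset.prod_const]
  · exact (Function.Involutive.toPerm_involutive _ : _)
  · intro h hh
    simp only [Finset.mem_image, Finset.mem_filter, Finset.mem_univ, true_and] at hh ⊢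
    obtain ⟨e, he, rfl⟩ := hh
    rintro ⟨e', he', h1⟩
    rw [flipOn_apply, o.edge_src, if_pos he] at h1
    have h2 := congrArg Γ.edge h1
    rw [edge_flip, o.edge_src, o.edge_src] at h2
    exact o.tgt_ne_src e (by rw [Orientation.tgt, ← h1, h2])
  · intro h hh
    rw [flipOn_apply] at hh ⊢
    have hD : D (Γ.edge h) = true := by
      by_contra hD
      simp [hD] at hh
    simp only [Finset.mem_image, Finset.mem_filter, Finset.mem_univ, true_and, if_pos hD]
    rcases o.eq_src_or_eq_tgt h with h1 | h1
    · exact Or.inl ⟨_, hD, h1.symm⟩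
    · refine Or.inr ⟨_, hD, ?_⟩
      conv_rhs => rw [h1]
      rw [o.flip_tgt]

/-! ### The permutation attached to a set of faces -/

/-- The restriction of `faceNext` to the faces with colour `true`. -/
def faceNextOn (Γ : EmbeddedGraph V E H) (c : H → Bool) (hc : ∀ h, c (Γ.faceNext h) = c h) :
    Equiv.Perm H where
  toFun h := if c h then Γ.faceNext h else h
  invFun h := if c h then Γ.faceNext.symm h else h
  left_inv h := by by_cases h1 : c h <;> simp [h1, hc]
  right_inv h := by
    have := hc (Γ.faceNext.symm h)
    rw [Equiv.apply_symm_apply] at this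
    by_cases h1 : c h <;> simp [h1, ← this]

theorem faceNextOn_apply (c : H → Bool) (hc : ∀ h, c (Γ.faceNext h) = c h) (h : H) :
    Γ.faceNextOn c hc h = if c h then Γ.faceNext h else h := rfl

theorem Orientation.IsKasteleyn.sign_faceNextOn [Fintype H] [DecidableEq H] {o : Γ.Orientation}
    (hK : o.IsKasteleyn) (c : H → Bool) (hc : ∀ h, c (Γ.faceNext h) = c h) :
    Equiv.Perm.sign (Γ.faceNextOn c hc) = ∏ h, if c h then -o.mismatch h else 1 :=
  Equiv.Perm.sign_eq_prod_of_eqOn Γ.faceNext _ (fun h => c h = true) o.mismatch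
    (fun h => by rw [hc]) (fun h h1 => by rw [faceNextOn_apply, if_pos h1])
    (fun h h1 => by rw [faceNextOn_apply, if_neg h1]) hK.prod_mismatch

/-- The rotation by one step around the vertices all of whose corners have colour `true`. -/
def turnInterior (htri : Γ.IsTrivalent) [Finite H] (c : H → Bool) : Equiv.Perm H where
  toFun h := if c h ∧ c (Γ.next h) ∧ c (Γ.next (Γ.next h)) then Γ.next h else h
  invFun h := if c h ∧ c (Γ.next h) ∧ c (Γ.next (Γ.next h)) then Γ.next (Γ.next h) else h
  left_inv h := by
    by_cases h1 : c h ∧ c (Γ.next h) ∧ c (Γ.next (Γ.next h))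
    · simp [h1, htri.next_next_next]
    · simp only [if_neg h1]
  right_inv h := by
    by_cases h1 : c h ∧ c (Γ.next h) ∧ c (Γ.next (Γ.next h))
    · simp [h1, htri.next_next_next]
    · simp only [if_neg h1]

theorem turnInterior_apply (htri : Γ.IsTrivalent) [Finite H] (c : H → Bool) (h : H) :
    turnInterior htri c h =
      if c h ∧ c (Γ.next h) ∧ c (Γ.next (Γ.next h)) then Γ.next h else h := rfl

theorem sign_turnInterior (htri : Γ.IsTrivalent) [Fintype H] [DecidableEq H] (c : H → Bool) :
    Equiv.Perm.sign (turnInterior htri c) = 1 := by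
  have h3 : turnInterior htri c ^ 3 = 1 := by
    ext h
    simp only [pow_succ, pow_zero, one_mul, Equiv.Perm.mul_apply, Equiv.Perm.one_apply]
    by_cases h1 : c h ∧ c (Γ.next h) ∧ c (Γ.next (Γ.next h))
    · simp [turnInterior_apply, h1, htri.next_next_next]
    · simp only [turnInterior_apply, if_neg h1]
  have h4 := congrArg Equiv.Perm.sign h3
  rw [map_pow, map_one] at h4
  rcases Int.units_eq_one_or (Equiv.Perm.sign (turnInterior htri c)) with h5 | h5
  · exact h5
  · rw [h5] at h4
    exact absurd h4 (by decide)

/-- At a vertex where both colours occur there is one half-edge `h` such that the corner following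
`h` has colour `true` and the one preceding it has colour `false`; exchange `h` and `next h`
there. -/
def swapBoundary (htri : Γ.IsTrivalent) [Finite H] (c : H → Bool) : Equiv.Perm H :=
  Function.Involutive.toPerm
    (fun h => if c h ∧ ¬ c (Γ.next (Γ.next h)) then Γ.next h
      else if ¬ c (Γ.next h) ∧ c (Γ.next (Γ.next h)) then Γ.next (Γ.next h) else h) fun h => by
    cases h1 : c h <;> cases h2 : c (Γ.next h) <;> cases h3 : c (Γ.next (Γ.next h)) <;>
      simp [h1, h2, h3, htri.next_next_next]

theorem swapBoundary_apply (htri : Γ.IsTrivalent) [Finite H] (c : H → Bool) (h : H) :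
    swapBoundary htri c h = if c h ∧ ¬ c (Γ.next (Γ.next h)) then Γ.next h
      else if ¬ c (Γ.next h) ∧ c (Γ.next (Γ.next h)) then Γ.next (Γ.next h) else h := rfl

theorem sign_swapBoundary (htri : Γ.IsTrivalent) [Fintype H] [DecidableEq H] (c : H → Bool) :
    Equiv.Perm.sign (swapBoundary htri c) =
      ∏ h, if c h ∧ ¬ c (Γ.next (Γ.next h)) then -1 else 1 := by
  rw [Equiv.Perm.sign_of_involutive
    (Finset.univ.filter fun h => c h = true ∧ ¬ c (Γ.next (Γ.next h)) = true),
    ← Finset.prod_filter, Finset.prod_const]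
  · exact (Function.Involutive.toPerm_involutive _ : _)
  · intro h
    simp only [Finset.mem_filter, Finset.mem_univ, true_and]
    rintro h1
    rw [swapBoundary_apply, if_pos h1, htri.next_next_next]
    exact fun h2 => h2.2 h1.1
  · intro h
    simp only [Finset.mem_filter, Finset.mem_univ, true_and, swapBoundary_apply]
    split_ifs with h1 h2
    · exact fun _ => Or.inl h1
    · exact fun _ => Or.inr ⟨h2.2, by rw [htri.next_next_next]; exact h2.1⟩
    · exact fun h3 => absurd rfl h3

theorem colour_flip (htri : Γ.IsTrivalent) [Finite H] {c : H → Bool}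
    (hc : ∀ h, c (Γ.faceNext h) = c h) (h : H) : c (Γ.flip h) = c (Γ.next (Γ.next h)) := by
  rw [← hc, htri.faceNext_apply, flip_flip]

/-- The permutation comparing the matching of the half-edges by the edges with the matching which
agrees with it off the boundary `γ` of the faces with colour `true`, and which on `γ` pairs the
half-edges that meet at a vertex. -/
def Orientation.boundaryPerm (htri : Γ.IsTrivalent) [Finite H] (o : Γ.Orientation) (c : H → Bool)
    (hc : ∀ h, c (Γ.faceNext h) = c h) : Equiv.Perm H :=
  swapBoundary htri c * turnInterior htri c * Γ.faceNextOn c hc * Γ.flipOn fun e => c (o.tgt e)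

/-- The signs cancel edge by edge: this is where the Kasteleyn condition enters. -/
theorem Orientation.IsKasteleyn.sign_boundaryPerm [Fintype E] [Fintype H] [DecidableEq H]
    (htri : Γ.IsTrivalent) {o : Γ.Orientation} (hK : o.IsKasteleyn) (c : H → Bool)
    (hc : ∀ h, c (Γ.faceNext h) = c h) :
    Equiv.Perm.sign (o.boundaryPerm htri c hc) = 1 := by
  rw [Orientation.boundaryPerm, Equiv.Perm.sign_mul, Equiv.Perm.sign_mul, Equiv.Perm.sign_mul,
    sign_turnInterior, hK.sign_faceNextOn, sign_swapBoundary, o.sign_flipOn, o.prod_halfEdges,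
    o.prod_halfEdges, mul_one, ← Finset.prod_mul_distrib, ← Finset.prod_mul_distrib]
  refine Finset.prod_eq_one fun e _ => ?_
  simp only [← colour_flip htri hc, o.flip_tgt, Orientation.mismatch, o.edge_tgt, o.edge_src,
    if_neg (o.tgt_ne_src e).symm, if_true]
  rw [show Γ.flip (o.src e) = o.tgt e from rfl]
  cases c (o.tgt e) <;> cases c (o.src e) <;> simp

theorem Orientation.boundaryPerm_apply (htri : Γ.IsTrivalent) [Finite H] (o : Γ.Orientation)
    (c : H → Bool) (hc : ∀ h, c (Γ.faceNext h) = c h) (h : H) :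
    o.boundaryPerm htri c hc h = swapBoundary htri c (turnInterior htri c (Γ.faceNextOn c hc
      (Γ.flipOn (fun e => c (o.tgt e)) h))) := rfl

/-- Off the boundary the comparison permutation is the identity. -/
theorem Orientation.boundaryPerm_of_eq (htri : Γ.IsTrivalent) [Finite H] (o : Γ.Orientation)
    (c : H → Bool) (hc : ∀ h, c (Γ.faceNext h) = c h) {h : H} (hh : c (Γ.flip h) = c h) :
    o.boundaryPerm htri c hc h = h := by
  have ht : c (o.tgt (Γ.edge h)) = c h := by
    rcases o.eq_src_or_eq_tgt h with h1 | h1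
    · rw [Orientation.tgt, ← h1, hh]
    · rw [← h1]
  have hn := colour_flip htri hc h
  rw [hh] at hn
  rw [o.boundaryPerm_apply, flipOn_apply, ht, faceNextOn_apply, swapBoundary_apply,
    turnInterior_apply]
  cases h1 : c h <;> cases h2 : c (Γ.next h) <;>
    simp [hh, h1, h2, ← hn, htri.faceNext_apply, flip_flip, htri.next_next_next]

/-- On the boundary the comparison permutation sends the two halves of an edge to the source and
the target of an angle. -/
theorem Orientation.boundaryPerm_src (htri : Γ.IsTrivalent) [Finite H] (o : Γ.Orientation)
    (c : H → Bool) (hc : ∀ h, c (Γ.faceNext h) = c h) {e : E} (he : c (o.tgt e) ≠ c (o.src e)) :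
    o.boundaryPerm htri c hc (o.src e) = Γ.next (o.boundaryPerm htri c hc (o.tgt e)) := by
  have key : ∀ f, c f = false → c (Γ.flip f) = true →
      swapBoundary htri c (turnInterior htri c (Γ.faceNextOn c hc (Γ.flip f))) =
        Γ.next (swapBoundary htri c (turnInterior htri c (Γ.faceNextOn c hc f))) := by
    intro f h1 h2
    have h3 : c (Γ.next (Γ.next f)) = true := by rw [← colour_flip htri hc, h2]
    cases h4 : c (Γ.next f) <;>
    simp [faceNextOn_apply, turnInterior_apply, swapBoundary_apply, h1, h2, h3, h4,
      htri.faceNext_apply, flip_flip, htri.next_next_next]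
  rw [o.boundaryPerm_apply, o.boundaryPerm_apply, flipOn_apply, flipOn_apply, o.edge_tgt,
    o.edge_src]
  cases ht : c (o.tgt e) with
  | false =>
    have hs : c (o.src e) = true := by rw [ht] at he; simpa using he.symm
    have := key (o.tgt e) ht (by rw [o.flip_tgt, hs])
    rw [o.flip_tgt] at this
    simpa using this
  | true =>
    have hs : c (o.src e) = false := by rw [ht] at he; simpa using he.symm
    have := key (o.src e) hs ht
    simpa [Orientation.tgt, flip_flip] using this

open scoped IsMulCommutative

/-! ### Berezin integrals of products of pairs -/

section Pairs

/-- The subalgebra generated by the products of two Grassmann variables. It is commutative. -/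
abbrev pairAlgebra (K : Type*) [CommRing K] (H : Type*) : Subalgebra K (Grassmann K H) :=
  Algebra.adjoin K (Set.range fun p : H × H => psi K p.1 * psi K p.2)

variable {K : Type*} [CommRing K]

instance : IsMulCommutative (pairAlgebra K H) :=
  Algebra.isMulCommutative_adjoin K (by
    rintro _ ⟨p, rfl⟩ _ ⟨q, rfl⟩
    exact commute_psi_mul_psi _ _ _ _)

variable (K) in
/-- The product of two Grassmann variables. -/
noncomputable def pair (a b : H) : pairAlgebra K H :=
  ⟨psi K a * psi K b, Algebra.subset_adjoin ⟨(a, b), rfl⟩⟩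

theorem coe_pair (a b : H) : (pair K a b : Grassmann K H) = psi K a * psi K b := rfl

theorem pair_mul_self (a b : H) : pair K a b * pair K a b = 0 := by
  refine Subtype.ext ?_
  change psi K a * psi K b * (psi K a * psi K b) = 0
  rw [mul_assoc, ← mul_assoc (psi K b), psi_mul_comm b a, neg_mul, mul_assoc (psi K a) (psi K b),
    psi_mul_self, mul_zero, neg_zero, mul_zero]

theorem coe_prod_pair {n : ℕ} (a b : Fin n → H) :
    open Classical in
    ((∏ i, pair K (a i) (b i) : pairAlgebra K H) : Grassmann K H) =
      ExteriorAlgebra.ιMulti K (n * 2) fun j => Pi.single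
        (if (finProdFinEquiv.symm j).2 = 0 then a (finProdFinEquiv.symm j).1
          else b (finProdFinEquiv.symm j).1) (1 : K) := by
  classical
  rw [← List.prod_ofFn, ← Subalgebra.coe_val, map_list_prod, List.map_ofFn,
    ExteriorAlgebra.ιMulti_apply, List.ofFn_mul, List.prod_flatten, List.map_ofFn]
  congr 2
  ext1 i
  have key : ∀ j : Fin 2, ∀ hj, (⟨(i : ℕ) * 2 + (j : ℕ), hj⟩ : Fin (n * 2)) =
      finProdFinEquiv (i, j) := fun j hj => Fin.ext (by simp; ring)
  simp only [Function.comp_apply, key, Equiv.symm_apply_apply]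
  simp [coe_pair, psi]

/-- A product of pairs has nonzero integral only if each half-edge occurs in it exactly once. -/
theorem injective_of_berezin_ne_zero [Fintype E] {ι : Type*} (o : Γ.Orientation) (t : Finset ι)
    (a b : ι → H)
    (h0 : berezin K o ((∏ i ∈ t, pair K (a i) (b i) : pairAlgebra K H) : Grassmann K H) ≠ 0) :
    t.card = Fintype.card E ∧
      Function.Injective fun p : t × Fin 2 => if p.2 = 0 then a p.1 else b p.1 := by
  classical
  rw [← Finset.prod_coe_sort, ← t.equivFin.symm.prod_comp, coe_prod_pair] at h0
  have hcard : t.card = Fintype.card E := by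
    by_contra hne
    exact h0 (berezin_of_ne o (fun h => hne (Nat.eq_of_mul_eq_mul_right two_pos h)) _)
  refine ⟨hcard, ?_⟩
  rintro ⟨i, j⟩ ⟨i', j'⟩ h
  by_contra hne
  refine h0 ?_
  rw [AlternatingMap.map_eq_zero_of_eq _ _ (i := finProdFinEquiv (t.equivFin i, j))
    (j := finProdFinEquiv (t.equivFin i', j')), map_zero]
  · simp only [Equiv.symm_apply_apply]
    exact congrArg (fun x => Pi.single x (1 : K)) h
  · intro h1
    apply hne
    simpa using h1

theorem berezin_prod_pair_perm [Fintype E] [Fintype H] [DecidableEq H] (o : Γ.Orientation)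
    (π : Equiv.Perm H) :
    berezin K o ((∏ e, pair K (π (o.tgt e)) (π (o.src e)) : pairAlgebra K H) : Grassmann K H) =
      ((Equiv.Perm.sign π : ℤ) : K) := by
  classical
  -- The product over the edges as a monomial, for any relabelling of the half-edges.
  have hmon : ∀ π : Equiv.Perm H,
      ((∏ e, pair K (π (o.tgt e)) (π (o.src e)) : pairAlgebra K H) : Grassmann K H) =
        ExteriorAlgebra.ιMulti K (Fintype.card E * 2) fun j =>
          Pi.single (π (o.halfEdgeOrder j)) (1 : K) := by
    intro π
    rw [← (Fintype.equivFin E).symm.prod_comp, coe_prod_pair]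
    congr 1
    ext1 j
    congr 1
    · exact Subsingleton.elim _ _
    · simp only [Orientation.halfEdgeOrder, Equiv.trans_apply, Equiv.ofBijective_apply,
        Equiv.prodCongr_apply, Prod.map_snd, Prod.map_fst, Equiv.refl_apply]
      exact (apply_ite π _ _ _).symm
  have hone : berezin K o
      ((∏ e, pair K (o.tgt e) (o.src e) : pairAlgebra K H) : Grassmann K H) = 1 := by
    rw [← berezin_top (K := K) o Finset.univ.toList (Finset.nodup_toList _) (by simp),
      ← Finset.prod_map_toList, ← Subalgebra.coe_val, map_list_prod, List.map_map]
    rfl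
  have h1 := hmon 1
  simp only [Equiv.Perm.one_apply] at h1
  rw [h1] at hone
  have h2 : (fun j => Pi.single (π (o.halfEdgeOrder j)) (1 : K)) =
      (fun j => Pi.single (o.halfEdgeOrder j) (1 : K)) ∘
        (o.halfEdgeOrder.symm.permCongr π) := by
    ext1 j
    simp [Equiv.permCongr_apply]
  rw [hmon π, h2, AlternatingMap.map_perm, Equiv.Perm.sign_permCongr, Units.smul_def, map_zsmul,
    hone, zsmul_one]

end Pairs

theorem _root_.IsNilpotent.exp_sum_of_mul_self {R ι : Type*} [CommRing R] [Module ℚ R]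
    (s : Finset ι) (f : ι → R) (hf : ∀ i, f i * f i = 0) :
    IsNilpotent.exp (∑ i ∈ s, f i) = ∏ i ∈ s, (1 + f i) := by
  classical
  have hnil : ∀ i, IsNilpotent (f i) := fun i => ⟨2, by rw [pow_two, hf]⟩
  induction s using Finset.induction_on with
  | empty => simp [IsNilpotent.exp_zero]
  | insert a s ha ih =>
    rw [Finset.sum_insert ha, Finset.prod_insert ha, IsNilpotent.exp_add_of_commute
      (Commute.all _ _) (hnil a) (isNilpotent_sum fun i _ => hnil i), ih,
      IsNilpotent.exp_eq_sum (k := 2) (by rw [pow_two, hf])]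
    simp [Finset.sum_range_succ]

/-! ### Expansion of the fermionic partition function -/

/-- The first factor of the quadratic term of an edge or of an angle. -/
def Orientation.fstHalf (o : Γ.Orientation) : E ⊕ H → H := Sum.elim o.tgt id

/-- The second factor of the quadratic term of an edge or of an angle. -/
def Orientation.sndHalf (o : Γ.Orientation) : E ⊕ H → H := Sum.elim o.src Γ.next

theorem fermionZ_eq_sum {K : Type*} [CommRing K] [Algebra ℚ K] [Fintype E] [Fintype H]
    (o : Γ.Orientation) (X : H → K) :
    fermionZ o X = ∑ t : Finset (E ⊕ H), (∏ i ∈ t, Sum.elim (fun _ => 1) X i) *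
      berezin K o ((∏ i ∈ t, pair K (o.fstHalf i) (o.sndHalf i) : pairAlgebra K H) :
        Grassmann K H) := by
  classical
  set f : E ⊕ H → pairAlgebra K H := fun i =>
    Sum.elim (fun _ => 1) X i • pair K (o.fstHalf i) (o.sndHalf i) with hf
  have hf0 : ∀ i, f i * f i = 0 := fun i => by
    rw [hf, smul_mul_smul_comm, pair_mul_self, smul_zero]
  have hact : fermionAction o X = (pairAlgebra K H).val (∑ i, f i) := by
    rw [map_sum, Fintype.sum_sum_type, fermionAction]
    simp [hf, Orientation.fstHalf, Orientation.sndHalf, coe_pair]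
  rw [fermionZ, hact, ← IsNilpotent.map_exp
    (isNilpotent_sum fun i _ => (⟨2, by rw [pow_two, hf0]⟩ : IsNilpotent (f i))),
    IsNilpotent.exp_sum_of_mul_self _ _ hf0, Finset.prod_one_add, map_sum, map_sum,
    Finset.powerset_univ]
  refine Finset.sum_congr rfl fun t _ => ?_
  rw [hf, Finset.prod_smul, map_smul, map_smul, smul_eq_mul]
  rfl

open scoped Classical in
/-- The terms of the action selected by an even subgraph `γ`: the edges off `γ` and the angles with
both sides in `γ`. -/
noncomputable def selectedTerms (Γ : EmbeddedGraph V E H) [Fintype E] [Fintype H] (γ : Finset E) :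
    Finset (E ⊕ H) :=
  Finset.univ.filter (Sum.elim (fun e => e ∉ γ) fun h => Γ.edge h ∈ γ ∧ Γ.edge (Γ.next h) ∈ γ)

theorem inl_mem_selectedTerms [Fintype E] [Fintype H] {γ : Finset E} {e : E} :
    Sum.inl e ∈ Γ.selectedTerms γ ↔ e ∉ γ := by simp [selectedTerms]

theorem inr_mem_selectedTerms [Fintype E] [Fintype H] {γ : Finset E} {h : H} :
    Sum.inr h ∈ Γ.selectedTerms γ ↔ Γ.edge h ∈ γ ∧ Γ.edge (Γ.next h) ∈ γ := by
  simp [selectedTerms]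

theorem selectedTerms_injective [Fintype E] [Fintype H] :
    Function.Injective Γ.selectedTerms := by
  intro γ γ' h
  ext e
  rw [← not_iff_not, ← inl_mem_selectedTerms (Γ := Γ), h, inl_mem_selectedTerms]

/-- The monomials with nonzero integral come from even subgraphs. -/
theorem exists_even_of_berezin_ne_zero {K : Type*} [CommRing K] [Fintype E] [Fintype H]
    (htri : Γ.IsTrivalent) (o : Γ.Orientation) (t : Finset (E ⊕ H))
    (h0 : berezin K o ((∏ i ∈ t, pair K (o.fstHalf i) (o.sndHalf i) : pairAlgebra K H) :
      Grassmann K H) ≠ 0) :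
    ∃ γ ∈ Γ.evenSubgraphs, Γ.selectedTerms γ = t := by
  classical
  obtain ⟨hcard, hinj⟩ := injective_of_berezin_ne_zero o t _ _ h0
  have hbij := (Fintype.bijective_iff_injective_and_card _).2 ⟨hinj, by
    rw [Fintype.card_prod, Fintype.card_fin, Fintype.card_coe, hcard, o.card_halfEdges]⟩
  have hfst : ∀ i ∈ t, ∀ j ∈ t, o.fstHalf i = o.fstHalf j → i = j := fun i hi j hj h => by
    have := @hinj (⟨i, hi⟩, 0) (⟨j, hj⟩, 0) (by simpa using h)
    simpa using this
  have hsnd : ∀ i ∈ t, ∀ j ∈ t, o.sndHalf i = o.sndHalf j → i = j := fun i hi j hj h => by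
    have := @hinj (⟨i, hi⟩, 1) (⟨j, hj⟩, 1) (by simpa using h)
    simpa using this
  have hne : ∀ i ∈ t, ∀ j ∈ t, o.fstHalf i ≠ o.sndHalf j := fun i hi j hj h => by
    have := @hinj (⟨i, hi⟩, 0) (⟨j, hj⟩, 1) (by simpa using h)
    simp at this
  have hsurj : ∀ h, ∃ i ∈ t, o.fstHalf i = h ∨ o.sndHalf i = h := fun h => by
    obtain ⟨⟨⟨i, hi⟩, j⟩, hij⟩ := hbij.2 h
    fin_cases j
    · exact ⟨i, hi, Or.inl (by simpa using hij)⟩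
    · exact ⟨i, hi, Or.inr (by simpa using hij)⟩
  -- Each half-edge is covered by its edge, by the angle following it or by the one preceding it,
  -- and by only one of these.
  have h1 : ∀ h, Sum.inl (Γ.edge h) ∈ t → Sum.inr h ∉ t := fun h hl hr => by
    rcases o.eq_src_or_eq_tgt h with h2 | h2
    · exact hne _ hr _ hl h2
    · exact absurd (hfst _ hr _ hl h2) (by simp)
  have h2 : ∀ h, Sum.inl (Γ.edge (Γ.next h)) ∈ t → Sum.inr h ∉ t := fun h hl hr => by
    rcases o.eq_src_or_eq_tgt (Γ.next h) with h2 | h2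
    · exact absurd (hsnd _ hr _ hl h2) (by simp)
    · exact hne _ hl _ hr h2.symm
  have h3 : ∀ h, Sum.inr h ∈ t → Sum.inr (Γ.next h) ∉ t := fun h hr hr' => hne _ hr' _ hr rfl
  have h4 : ∀ h, Sum.inl (Γ.edge h) ∈ t ∨ Sum.inr h ∈ t ∨ Sum.inr (Γ.next (Γ.next h)) ∈ t := by
    intro h
    obtain ⟨i | g, hi, h5⟩ := hsurj h
    · left
      have : Γ.edge h = i := by
        rcases h5 with h5 | h5
        · rw [← h5]; exact o.edge_tgt i
        · rw [← h5]; exact o.edge_src i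
      rwa [this]
    · right
      rcases h5 with h5 | h5
      · left; rwa [← h5]
      · right
        rw [← h5]
        change Sum.inr (Γ.next (Γ.next (Γ.next g))) ∈ t
        rwa [htri.next_next_next]
  have hγ : ∀ e, e ∈ Finset.univ.filter (fun e => Sum.inl e ∉ t) ↔ Sum.inl e ∉ t := by simp
  have n3 := htri.next_next_next
  refine ⟨Finset.univ.filter fun e => Sum.inl e ∉ t, ?_, ?_⟩
  · rw [mem_evenSubgraphs_iff htri]
    intro h
    rw [hγ, hγ, hγ]
    have a1 := h1 h
    have a2 := h1 (Γ.next h)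
    have a3 := h1 (Γ.next (Γ.next h))
    have b1 := h2 h
    have b2 := h2 (Γ.next h)
    have b3 := h2 (Γ.next (Γ.next h))
    have c1 := h3 h
    have c2 := h3 (Γ.next h)
    have c3 := h3 (Γ.next (Γ.next h))
    have d1 := h4 h
    have d2 := h4 (Γ.next h)
    have d3 := h4 (Γ.next (Γ.next h))
    rw [n3] at b3 c3 d2 d3
    clear hfst hsnd hne hsurj hinj hbij h1 h2 h3 h4 hγ h0
    grind
  · ext i
    rcases i with e | h
    · rw [inl_mem_selectedTerms, hγ, not_not]
    · rw [inr_mem_selectedTerms, hγ, hγ]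
      have a1 := h1 h
      have b1 := h2 h
      have c2 := h3 (Γ.next h)
      have d1 := h4 h
      have d2 := h4 (Γ.next h)
      rw [n3] at d2
      clear hfst hsnd hne hsurj hinj hbij h1 h2 h3 h4 hγ h0
      grind

theorem boundaryPerm_of_edge_notMem [Finite H] (htri : Γ.IsTrivalent) (o : Γ.Orientation)
    {γ : Finset E} (c : H → Bool) (hc : ∀ h, c (Γ.faceNext h) = c h)
    (hcγ : ∀ h, Γ.edge h ∈ γ ↔ c h ≠ c (Γ.flip h)) {h : H} (hh : Γ.edge h ∉ γ) :
    o.boundaryPerm htri c hc h = h :=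
  o.boundaryPerm_of_eq htri c hc (not_ne_iff.1 ((hcγ h).not.1 hh)).symm

theorem edge_boundaryPerm_mem_iff [Finite H] (htri : Γ.IsTrivalent) (o : Γ.Orientation)
    {γ : Finset E} (c : H → Bool) (hc : ∀ h, c (Γ.faceNext h) = c h)
    (hcγ : ∀ h, Γ.edge h ∈ γ ↔ c h ≠ c (Γ.flip h)) (h : H) :
    Γ.edge (o.boundaryPerm htri c hc h) ∈ γ ↔ Γ.edge h ∈ γ := by
  constructor
  · intro h1
    by_contra h2
    rw [boundaryPerm_of_edge_notMem htri o c hc hcγ h2] at h1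
    exact h2 h1
  · intro h1
    by_contra h2
    have h3 := boundaryPerm_of_edge_notMem htri o c hc hcγ h2
    rw [(o.boundaryPerm htri c hc).injective h3] at h2
    exact h2 h1

theorem boundaryPerm_src_of_mem [Finite H] (htri : Γ.IsTrivalent) (o : Γ.Orientation)
    {γ : Finset E} (c : H → Bool) (hc : ∀ h, c (Γ.faceNext h) = c h)
    (hcγ : ∀ h, Γ.edge h ∈ γ ↔ c h ≠ c (Γ.flip h)) {e : E} (he : e ∈ γ) :
    o.boundaryPerm htri c hc (o.src e) = Γ.next (o.boundaryPerm htri c hc (o.tgt e)) := by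
  refine o.boundaryPerm_src htri c hc ?_
  rw [← o.flip_tgt e]
  exact (hcγ _).1 (by rwa [o.edge_tgt])

open scoped Classical in
/-- The selected terms, indexed by the edges: an edge of `γ` corresponds to the angle formed by the
images of its two halves under the comparison permutation. -/
theorem prod_selectedTerms [Fintype E] [Fintype H] {M : Type*} [CommMonoid M]
    (htri : Γ.IsTrivalent) (o : Γ.Orientation) {γ : Finset E} (hγ : γ ∈ Γ.evenSubgraphs)
    (c : H → Bool) (hc : ∀ h, c (Γ.faceNext h) = c h)
    (hcγ : ∀ h, Γ.edge h ∈ γ ↔ c h ≠ c (Γ.flip h)) (F : E ⊕ H → M) :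
    ∏ i ∈ Γ.selectedTerms γ, F i =
      ∏ e, F (if e ∈ γ then Sum.inr (o.boundaryPerm htri c hc (o.tgt e)) else Sum.inl e) := by
  have hmem := edge_boundaryPerm_mem_iff htri o c hc hcγ
  have hsrc := fun e (he : e ∈ γ) => boundaryPerm_src_of_mem htri o c hc hcγ he
  symm
  refine Finset.prod_bij (fun e _ => if e ∈ γ then Sum.inr (o.boundaryPerm htri c hc (o.tgt e))
    else Sum.inl e) ?_ ?_ ?_ fun _ _ => rfl
  · intro e _
    split_ifs with he
    · rw [inr_mem_selectedTerms, ← hsrc e he, hmem, hmem, o.edge_tgt, o.edge_src]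
      exact ⟨he, he⟩
    · rwa [inl_mem_selectedTerms]
  · intro e _ e' _ h
    split_ifs at h
    · have h1 := (o.boundaryPerm htri c hc).injective (Sum.inr.inj h)
      rw [← o.edge_tgt e, h1, o.edge_tgt]
    · exact Sum.inl.inj h
  · rintro (e | g) hi
    · rw [inl_mem_selectedTerms] at hi
      exact ⟨e, Finset.mem_univ _, if_neg hi⟩
    · rw [inr_mem_selectedTerms] at hi
      obtain ⟨h, rfl⟩ := (o.boundaryPerm htri c hc).surjective g
      have he : Γ.edge h ∈ γ := (hmem h).1 hi.1
      refine ⟨Γ.edge h, Finset.mem_univ _, ?_⟩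
      rw [if_pos he]
      rcases o.eq_src_or_eq_tgt h with h1 | h1
      · -- The target of an angle is not the source of another one: not all three half-edges at a
        -- vertex are in `γ`.
        exfalso
        have h2 := hsrc _ he
        rw [← h1] at h2
        have h3 : Γ.edge (Γ.next (Γ.next (o.boundaryPerm htri c hc h))) ∈ γ := by
          rw [h2, htri.next_next_next, hmem, o.edge_tgt]
          exact he
        have := (mem_evenSubgraphs_iff htri γ).1 hγ (o.boundaryPerm htri c hc h)
        tauto
      · rw [← h1]

/-- Each even subgraph contributes with sign `+1`. -/
theorem berezin_selectedTerms {K : Type*} [CommRing K] [Fintype V] [Fintype E] [Fintype H]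
    (hconn : Γ.IsConnected) (hplanar : Γ.IsPlanar) (htri : Γ.IsTrivalent) {o : Γ.Orientation}
    (hK : o.IsKasteleyn) {γ : Finset E} (hγ : γ ∈ Γ.evenSubgraphs) (r : E → K) :
    (∏ i ∈ Γ.selectedTerms γ,
      Sum.elim (fun _ => 1) (fun h => r (Γ.edge h) * r (Γ.edge (Γ.next h))) i) *
      berezin K o ((∏ i ∈ Γ.selectedTerms γ, pair K (o.fstHalf i) (o.sndHalf i) :
        pairAlgebra K H) : Grassmann K H) = ∏ e ∈ γ, r e ^ 2 := by
  classical
  obtain ⟨c, hc, hcγ⟩ := exists_face_colouring hconn hplanar htri o hγ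
  have hmem := edge_boundaryPerm_mem_iff htri o c hc hcγ
  have hsrc := fun e (he : e ∈ γ) => boundaryPerm_src_of_mem htri o c hc hcγ he
  have hoff := fun h (hh : Γ.edge h ∉ γ) => boundaryPerm_of_edge_notMem htri o c hc hcγ hh
  rw [prod_selectedTerms htri o hγ c hc hcγ, prod_selectedTerms htri o hγ c hc hcγ]
  set π := o.boundaryPerm htri c hc
  have hpair : ∀ e, pair K (o.fstHalf (if e ∈ γ then Sum.inr (π (o.tgt e)) else Sum.inl e))
      (o.sndHalf (if e ∈ γ then Sum.inr (π (o.tgt e)) else Sum.inl e)) =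
      pair K (π (o.tgt e)) (π (o.src e)) := by
    intro e
    split_ifs with he
    · rw [hsrc e he]; rfl
    · rw [hoff _ (by rwa [o.edge_tgt]), hoff _ (by rwa [o.edge_src])]; rfl
  rw [Finset.prod_congr rfl fun e _ => hpair e, berezin_prod_pair_perm, hK.sign_boundaryPerm]
  -- Each half-edge of `γ` contributes a factor `r`, and `π` permutes these half-edges.
  set r' : H → K := fun h => if Γ.edge h ∈ γ then r (Γ.edge h) else 1 with hr'
  have hcoef : ∀ e, Sum.elim (fun _ => 1) (fun h => r (Γ.edge h) * r (Γ.edge (Γ.next h)))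
      (if e ∈ γ then Sum.inr (π (o.tgt e)) else Sum.inl e) =
      r' (π (o.tgt e)) * r' (π (o.src e)) := by
    intro e
    simp only [hr', hmem, o.edge_tgt, o.edge_src]
    split_ifs with he
    · rw [hsrc e he]; rfl
    · simp
  rw [Finset.prod_congr rfl fun e _ => hcoef e, ← o.prod_halfEdges fun h => r' (π h),
    Equiv.prod_comp π r', o.prod_halfEdges]
  simp only [hr', o.edge_tgt, o.edge_src, Units.val_one, Int.cast_one, mul_one]
  rw [← Finset.prod_filter_mul_prod_filter_not Finset.univ (· ∈ γ)]
  rw [Finset.prod_congr (g := fun e => r e ^ 2) (Finset.filter_univ_mem γ) fun e he => by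
    rw [if_pos he, pow_two], Finset.prod_eq_one (s := Finset.univ.filter _) fun e he => by
    rw [if_neg (Finset.mem_filter.1 he).2, mul_one], mul_one]

/-- The fermionic partition function is the generating function of the even subgraphs. -/
theorem fermionZ_eq_sum_evenSubgraphs {K : Type*} [CommRing K] [Algebra ℚ K] [Fintype V]
    [Fintype E] [Fintype H] (hconn : Γ.IsConnected) (hplanar : Γ.IsPlanar)
    (htri : Γ.IsTrivalent) {o : Γ.Orientation} (hK : o.IsKasteleyn) (r : E → K) :
    fermionZ o (fun h => r (Γ.edge h) * r (Γ.edge (Γ.next h))) =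
      ∑ γ ∈ Γ.evenSubgraphs, ∏ e ∈ γ, r e ^ 2 := by
  classical
  rw [fermionZ_eq_sum]
  symm
  refine Finset.sum_of_injOn Γ.selectedTerms selectedTerms_injective.injOn
    (fun _ _ => Finset.mem_coe.2 (Finset.mem_univ _)) (fun t _ ht => ?_)
    fun γ hγ => (berezin_selectedTerms hconn hplanar htri hK hγ r).symm
  by_contra hne
  obtain ⟨γ, hγ, rfl⟩ := exists_even_of_berezin_ne_zero htri o t (right_ne_zero_of_mul hne)
  exact ht ⟨γ, hγ, rfl⟩

/-! ### The high-temperature expansion of the Ising model -/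

theorem exp_mul_units (y : ℝ) (s : ℤˣ) :
    Real.exp (y * ((s : ℤ) : ℝ)) = Real.cosh y * (1 + Real.tanh y * ((s : ℤ) : ℝ)) := by
  have h : Real.cosh y * Real.tanh y = Real.sinh y := by
    rw [Real.tanh_eq_sinh_div_cosh, mul_div_cancel₀ _ (Real.cosh_pos y).ne']
  rw [mul_add, mul_one, ← mul_assoc, h]
  rcases Int.units_eq_one_or s with rfl | rfl
  · simp [Real.cosh_add_sinh]
  · simp [← sub_eq_add_neg, Real.cosh_sub_sinh]

theorem sum_units_pow (n : ℕ) : ∑ s : ℤˣ, ((s : ℤ) : ℝ) ^ n = if Even n then 2 else 0 := by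
  rw [UnitsInt.univ, Finset.sum_pair (by decide)]
  split_ifs with h
  · simp [h.neg_one_pow]; norm_num
  · simp [(Nat.not_even_iff_odd.1 h).neg_one_pow]

open scoped Classical in
theorem prod_spins [Fintype V] [Fintype E] [Fintype H] (o : Γ.Orientation) (γ : Finset E)
    (σ : V → ℤˣ) :
    ∏ e ∈ γ, (((σ (Γ.vert (o.src e)) : ℤ) : ℝ) * ((σ (Γ.vert (o.tgt e)) : ℤ) : ℝ)) =
      ∏ v, ((σ v : ℤ) : ℝ) ^ Nat.card {h : H // Γ.vert h = v ∧ Γ.edge h ∈ γ} := by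
  have h1 : ∏ e ∈ γ, (((σ (Γ.vert (o.src e)) : ℤ) : ℝ) * ((σ (Γ.vert (o.tgt e)) : ℤ) : ℝ)) =
      ∏ h with Γ.edge h ∈ γ, ((σ (Γ.vert h) : ℤ) : ℝ) := by
    rw [Finset.prod_filter, o.prod_halfEdges]
    simp only [o.edge_tgt, o.edge_src]
    rw [← Finset.prod_subset (Finset.subset_univ γ)]
    · exact Finset.prod_congr rfl fun e he => by rw [if_pos he, if_pos he, mul_comm]
    · exact fun e _ he => by rw [if_neg he, if_neg he, mul_one]
  rw [h1, ← Finset.prod_fiberwise _ Γ.vert]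
  refine Finset.prod_congr rfl fun v _ => ?_
  rw [Finset.prod_congr rfl fun h hh => by rw [(Finset.mem_filter.1 hh).2], Finset.prod_const,
    Nat.card_eq_fintype_card, Fintype.card_subtype, Finset.filter_filter]
  simp only [and_comm]

open scoped Classical in
/-- Summing over the spins kills the sets of edges that are not even. -/
theorem sum_prod_spins [Fintype V] [Fintype E] [Fintype H] (o : Γ.Orientation) (γ : Finset E) :
    ∑ σ : V → ℤˣ,
      ∏ e ∈ γ, (((σ (Γ.vert (o.src e)) : ℤ) : ℝ) * ((σ (Γ.vert (o.tgt e)) : ℤ) : ℝ)) =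
      if γ ∈ Γ.evenSubgraphs then 2 ^ Fintype.card V else 0 := by
  simp only [prod_spins]
  rw [← Fintype.piFinset_univ, ← Finset.prod_univ_sum (fun _ => Finset.univ) fun v (s : ℤˣ) =>
    ((s : ℤ) : ℝ) ^ Nat.card {h : H // Γ.vert h = v ∧ Γ.edge h ∈ γ}]
  simp only [sum_units_pow]
  have hiff : γ ∈ Γ.evenSubgraphs ↔
      ∀ v, Even (Nat.card {h : H // Γ.vert h = v ∧ Γ.edge h ∈ γ}) := by simp [evenSubgraphs]
  split_ifs with hγ
  · rw [Finset.prod_congr rfl fun v _ => if_pos (hiff.1 hγ v), Finset.prod_const, Finset.card_univ]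
  · rw [hiff] at hγ
    push Not at hγ
    obtain ⟨v, hv⟩ := hγ
    exact Finset.prod_eq_zero (Finset.mem_univ v) (if_neg (by simpa using hv))

theorem isingZ_eq_sum_evenSubgraphs [Fintype V] [Fintype E] [Fintype H] (o : Γ.Orientation)
    (y : E → ℝ) :
    isingZ o y = (∏ e, Real.cosh (y e)) * 2 ^ Fintype.card V *
      ∑ γ ∈ Γ.evenSubgraphs, ∏ e ∈ γ, Real.tanh (y e) := by
  classical
  have hσ : ∀ σ : V → ℤˣ, Real.exp (∑ e : E, y e *
      (((σ (Γ.vert (o.src e)) : ℤ) : ℝ) * ((σ (Γ.vert (o.tgt e)) : ℤ) : ℝ))) =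
      (∏ e, Real.cosh (y e)) * ∑ γ : Finset E, (∏ e ∈ γ, Real.tanh (y e)) *
        ∏ e ∈ γ, (((σ (Γ.vert (o.src e)) : ℤ) : ℝ) * ((σ (Γ.vert (o.tgt e)) : ℤ) : ℝ)) := by
    intro σ
    have h1 : ∀ e, Real.exp (y e *
        (((σ (Γ.vert (o.src e)) : ℤ) : ℝ) * ((σ (Γ.vert (o.tgt e)) : ℤ) : ℝ))) =
        Real.cosh (y e) * (1 + Real.tanh (y e) *
          (((σ (Γ.vert (o.src e)) : ℤ) : ℝ) * ((σ (Γ.vert (o.tgt e)) : ℤ) : ℝ))) := fun e => by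
      simpa using exp_mul_units (y e) (σ (Γ.vert (o.src e)) * σ (Γ.vert (o.tgt e)))
    rw [Real.exp_sum, Finset.prod_congr rfl fun e _ => h1 e, Finset.prod_mul_distrib,
      Finset.prod_one_add, Finset.powerset_univ]
    simp only [Finset.prod_mul_distrib]
  have h2 : isingZ o y = ∑ σ : V → ℤˣ, Real.exp (∑ e : E, y e *
      (((σ (Γ.vert (o.src e)) : ℤ) : ℝ) * ((σ (Γ.vert (o.tgt e)) : ℤ) : ℝ))) := by
    rw [isingZ]
  rw [h2, Finset.sum_congr rfl fun σ _ => hσ σ, ← Finset.mul_sum, Finset.sum_comm, mul_assoc]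
  congr 1
  rw [Finset.sum_congr rfl fun γ _ => by rw [← Finset.mul_sum, sum_prod_spins], Finset.mul_sum]
  simp only [mul_ite, mul_zero, Finset.sum_ite_mem, Finset.univ_inter]
  exact Finset.sum_congr rfl fun γ _ => mul_comm _ _

end EmbeddedGraph

theorem mainTheorem3 {V E H : Type*} [Fintype V] [Fintype E] [Fintype H]
    (Γ : EmbeddedGraph V E H) (hconn : Γ.IsConnected) (hbridge : Γ.IsBridgeless)
    (hplanar : Γ.IsPlanar) (htri : Γ.IsTrivalent)
    (o : Γ.Orientation) (hK : o.IsKasteleyn) :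
    (∀ y : E → ℝ, ∀ r : E → ℂ, (∀ e, r e ^ 2 = ((Real.tanh (y e) : ℝ) : ℂ)) →
      ((EmbeddedGraph.isingZ o y : ℝ) : ℂ) =
        ((∏ e, Real.cosh (y e) : ℝ) : ℂ) * 2 ^ Fintype.card V *
          EmbeddedGraph.fermionZ o (fun h => r (Γ.edge h) * r (Γ.edge (Γ.next h)))) ∧
    (∀ y : E → ℝ, (∀ e, 0 ≤ y e) →
      EmbeddedGraph.isingZ o y =
        (∏ e, Real.cosh (y e)) * 2 ^ Fintype.card V *
          EmbeddedGraph.fermionZ o (fun h =>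
            √(Real.tanh (y (Γ.edge h)) * Real.tanh (y (Γ.edge (Γ.next h)))))) ∧
    (∀ Y r : E → ℂ, (∀ e, r e ^ 2 = Y e) →
      EmbeddedGraph.fermionZ o (fun h => r (Γ.edge h) * r (Γ.edge (Γ.next h))) =
        ∑ γ ∈ Γ.evenSubgraphs, ∏ e ∈ γ, Y e) := by
  refine ⟨fun y r hr => ?_, fun y hy => ?_, fun Y r hr => ?_⟩
  · rw [EmbeddedGraph.fermionZ_eq_sum_evenSubgraphs hconn hplanar htri hK,
      EmbeddedGraph.isingZ_eq_sum_evenSubgraphs]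
    simp only [hr]
    push_cast
    rfl
  · have htanh : ∀ e, 0 ≤ Real.tanh (y e) := fun e => by
      rw [Real.tanh_eq_sinh_div_cosh]
      exact div_nonneg (Real.sinh_nonneg_iff.2 (hy e)) (Real.cosh_pos _).le
    simp only [Real.sqrt_mul (htanh _)]
    rw [EmbeddedGraph.fermionZ_eq_sum_evenSubgraphs hconn hplanar htri hK
      (fun e => √(Real.tanh (y e))), EmbeddedGraph.isingZ_eq_sum_evenSubgraphs]
    simp only [Real.sq_sqrt (htanh _)]
  · rw [EmbeddedGraph.fermionZ_eq_sum_evenSubgraphs hconn hplanar htri hK]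
    simp only [hr]
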